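/- Let $G=(V,E)$ be a finite simple undirected graph with $n$ vertices, $0<\varepsilon<1$, and let every edge have a weight $w(e)\in(0,1]$ that is an integer power of $1-\varepsilon/3$. For $F\subseteq E$ put $w(F)=\sum_{e\in F}w(e)$. For a matching $M$ and the edge set $p$ of a simple path or simple cycle of $G$ whose consecutive edges are alternately in $M$ and not in $M$, let the gain be $g_M(p)=w(p\setminus M)-w(p\cap M)$. Call $p$ $(M,[1,k])$-augmenting if the symmetric difference $M\oplus p$ is a matching, $g_M(p)>0$ and $|p\setminus M|\le k$. Let $w_{\min}(\varepsilon)=\max\{\varepsilon/n,\min_e w(e)\}$. Consider the following algorithm, with $k=\lceil 3/\varepsilon\rceil$, a number $L$ of phases, and a list $g_1>g_2>\dots>g_T$ of real numbers that contains every gain $g_M(p)$ of an $(M,[1,k])$-augmenting path or cycle $p$, for every matching $M$ of $G$. Start with $M=\emptyset$. In each of $L$ phases, for $j=1,\dots,T$ in this order, let $P$ be the set of all $(M,[1,k])$-augmenting paths and cycles of gain exactly $g_j$ with respect to the current $M$, let $H$ be the intersection graph over $P$ (two different elements are adjacent if and only if they share a vertex), choose a maximal independent set $P^*$ of $H$,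 and replace $M$ by $M\oplus\bigcup_{p\in P^*}p$. After the last phase return $M$. **Theorem.** There are absolute constants $c_L,c_T>0$ such that for all $G$, $w$, $\varepsilon$ as above: 1. If all edge weights are at least $\varepsilon/n$ and $w_{\min}(\varepsilon)<1$, then the number of distinct gains of $(M,[1,k])$-augmenting paths and cycles, over all matchings $M$ of $G$, is at most $\bigl(c_T\cdot\frac1\varepsilon\log\frac1{w_{\min}(\varepsilon)}\bigr)^{2k+1}$; so a list of length $T=T_k=\Theta\bigl(\frac1\varepsilon\log\frac1{w_{\min}(\varepsilon)}\bigr)^{2k+1}$ suffices. 2. For every $L\ge c_L\cdot\frac1\varepsilon\log\frac1\varepsilon$ (in particular for a suitable $L=\Theta(\frac1\varepsilon\log\frac1\varepsilon)$) and every list as above, the algorithm can always be carried out, and, whichever maximal independent sets are chosen, it returns a $(1-\varepsilon)$-approximate maximum weight matching: a matching $M$ of $G$ with $w(M)\ge(1-\varepsilon)\,w(M')$ for every matching $M'$ of $G$. -/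

import Mathlib

open scoped symmDiff

namespace WeightedMatching

universe u

variable {V : Type u} [Fintype V] [DecidableEq V]

/-- `M` is a matching of `G`: a set of edges of `G`, no two of which share an endpoint. -/
def IsMatching (G : SimpleGraph V) (M : Finset (Sym2 V)) : Prop :=
  (∀ e ∈ M, e ∈ G.edgeSet) ∧
    ∀ e ∈ M, ∀ f ∈ M, e ≠ f → ¬ ∃ v, v ∈ e ∧ v ∈ f

/-- The weight `w(F)` of a set `F` of edges. -/
noncomputable def weight (w : Sym2 V → ℝ) (F : Finset (Sym2 V)) : ℝ := ∑ e ∈ F, w e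

/-- `M` is an `α`-approximate maximum weight matching of `G`. -/
def IsApproxMWM (G : SimpleGraph V) (w : Sym2 V → ℝ) (α : ℝ) (M : Finset (Sym2 V)) : Prop :=
  IsMatching G M ∧ ∀ M' : Finset (Sym2 V), IsMatching G M' → α * weight w M' ≤ weight w M

/-- `p` is the edge set of a simple path or of a simple cycle of `G`. (Undirected paths and cycles
with at least one edge are identified with their edge sets.) -/
def IsSimplePathOrCycle (G : SimpleGraph V) (p : Finset (Sym2 V)) : Prop :=
  (∃ (u v : V) (q : G.Walk u v), q.IsPath ∧ q.edges.toFinset = p) ∨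
    (∃ (u : V) (q : G.Walk u u), q.IsCycle ∧ q.edges.toFinset = p)

/-- The edges of the path or cycle `p` are drawn alternately from `M` and from outside `M`: of two
consecutive edges, i.e. two different edges of `p` with a common vertex, exactly one is in `M`. -/
def IsAlternating (M p : Finset (Sym2 V)) : Prop :=
  ∀ e ∈ p, ∀ f ∈ p, e ≠ f → (∃ v, v ∈ e ∧ v ∈ f) → (e ∈ M ↔ f ∉ M)

/-- The gain `g_M(p) = w(p \ M) - w(p ∩ M)`. -/
noncomputable def gain (w : Sym2 V → ℝ) (M p : Finset (Sym2 V)) : ℝ :=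
  weight w (p \ M) - weight w (p ∩ M)

/-- `p` is `M`-augmenting: an `M`-alternating simple path or cycle of positive gain such that
`M ⊕ E(p)` is a matching. -/
def IsAugmenting (G : SimpleGraph V) (w : Sym2 V → ℝ) (M p : Finset (Sym2 V)) : Prop :=
  IsSimplePathOrCycle G p ∧ IsAlternating M p ∧ IsMatching G (M ∆ p) ∧ 0 < gain w M p

/-- `p` is `(M,[1,k])`-augmenting. -/
def IsBoundedAugmenting (G : SimpleGraph V) (w : Sym2 V → ℝ) (k : ℕ)
    (M p : Finset (Sym2 V)) : Prop :=
  IsAugmenting G w M p ∧ (p \ M).card ≤ k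

/-- The set of all `(M,[1,k])`-augmenting paths and cycles with gain `γ`. -/
def augPaths (G : SimpleGraph V) (w : Sym2 V → ℝ) (k : ℕ) (M : Finset (Sym2 V)) (γ : ℝ) :
    Set (Finset (Sym2 V)) :=
  {p | IsBoundedAugmenting G w k M p ∧ gain w M p = γ}

/-- The intersection graph over a set `P` of paths: two different paths are adjacent if and only if
they share a vertex. -/
def intersectionGraph (P : Set (Finset (Sym2 V))) : SimpleGraph P where
  Adj p q := p ≠ q ∧ ∃ v : V, (∃ e ∈ p.1, v ∈ e) ∧ (∃ e ∈ q.1, v ∈ e)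
  symm := ⟨fun _ _ ⟨h, v, hp, hq⟩ => ⟨h.symm, v, hq, hp⟩⟩
  loopless := ⟨fun _ h => h.1 rfl⟩

/-- `S` is a maximal independent set of `H`. -/
def IsMIS {α : Type u} (H : SimpleGraph α) (S : Set α) : Prop :=
  Maximal (fun I => H.IsIndepSet I) S

/-- One iteration of the inner loop: `M' = M ⊕ E(P*)`, where `P*` is some maximal independent set
of the intersection graph over the `(M,[1,k])`-augmenting paths and cycles with gain `γ`. -/
def AugStep (G : SimpleGraph V) (w : Sym2 V → ℝ) (k : ℕ) (γ : ℝ) (M M' : Finset (Sym2 V)) : Prop :=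
  ∃ S : Finset (augPaths G w k M γ),
    IsMIS (intersectionGraph (augPaths G w k M γ)) (S : Set (augPaths G w k M γ)) ∧
      M' = M ∆ S.biUnion (fun p => p.1)

/-- One phase (a full inner loop): starting from `M`, the gains `g 0, g 1, …, g (T - 1)` are
processed in this order, and the result is `M'`. -/
def Phase (G : SimpleGraph V) (w : Sym2 V → ℝ) (k : ℕ) {T : ℕ} (g : Fin T → ℝ)
    (M M' : Finset (Sym2 V)) : Prop :=
  ∃ N : ℕ → Finset (Sym2 V), N 0 = M ∧
    (∀ j : Fin T, AugStep G w k (g j) (N (j : ℕ)) (N ((j : ℕ) + 1))) ∧ N T = M'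

/-- `M` is a possible output of the global algorithm: `L` phases, starting from the empty matching.
The maximal independent sets may be chosen arbitrarily. -/
def IsOutput (G : SimpleGraph V) (w : Sym2 V → ℝ) (k L : ℕ) {T : ℕ} (g : Fin T → ℝ)
    (M : Finset (Sym2 V)) : Prop :=
  ∃ N : ℕ → Finset (Sym2 V), N 0 = ∅ ∧ (∀ i < L, Phase G w k g (N i) (N (i + 1))) ∧ N L = M

/-- All gains that `(M,[1,k])`-augmenting paths and cycles achieve, for matchings `M` of `G`. -/
def possibleGains (G : SimpleGraph V) (w : Sym2 V → ℝ) (k : ℕ) : Set ℝ :=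
  {γ | ∃ M p : Finset (Sym2 V), IsMatching G M ∧ IsBoundedAugmenting G w k M p ∧ gain w M p = γ}

/-- `w_min(ε) = max {ε / n, min_e w(e)}`, where `n` is the number of vertices. -/
noncomputable def wmin (G : SimpleGraph V) (w : Sym2 V → ℝ) (ε : ℝ) : ℝ :=
  max (ε / Fintype.card V) (sInf (w '' G.edgeSet))

end WeightedMatching

/-! Correctness is a local search argument. Fix the current matching M and a competitor M'. Regard
the edges of M' as vertices of a graph, linked when an edge of M joins them; its maximum degree is
two, so each distance layer of a component has at most two elements. Deleting the lightest residue
class of layers costs at most a fraction 2/(k+1) of w(M') and leaves blocks of at most k edges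
(`SimpleGraph.exists_light_deletion`). For the surviving part N of M', the components of M ∆ N are
paths and cycles with at most k edges outside M. Those of positive gain are vertex-disjoint
augmentations of total gain at least w(N) - w(M) (`exists_augmentations_of_isMatching`).

A phase earns at least a fraction 1/(2k+2) of the gain of any such family (`Phase.weight_ge`). Gains
are processed in decreasing order, so a member of the family is first touched by an augmentation of
at least its own gain; an augmentation has at most 2k+2 vertices, hence touches at most that many
disjoint members. With O = (1 - 2/(k+1)) w(M'), the deficit O - w(M) therefore contracts by 1 -
1/(2k+2) in each phase, and `one_sub_le_of_phases` checks that L phases are enough.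

For the number of gains: a gain is a sum of at most k weights minus a sum of at most k+1 weights,
and only O(ε⁻¹ log(1/w_min)) powers of 1 - ε/3 can occur as weights. -/

set_option linter.unusedSectionVars false
set_option linter.unusedDecidableInType false
set_option linter.unusedFintypeInType false

/-! ### Graphs of maximum degree two -/

/-- In a graph of maximum degree two, each distance layer of a component has at most two
elements. -/
lemma SimpleGraph.layer_le_two {α : Type*} (H : SimpleGraph α)
    (hdeg : ∀ v a b c, H.Adj v a → H.Adj v b → H.Adj v c → a = b ∨ b = c ∨ a = c) (r : α) (d : ℕ) :
    ∀ a b c, H.Reachable r a → H.Reachable r b → H.Reachable r c →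
      H.dist r a = d → H.dist r b = d → H.dist r c = d → a = b ∨ b = c ∨ a = c := by
  have pred : ∀ d a, H.Reachable r a → H.dist r a = d + 1 →
      ∃ a', H.Reachable r a' ∧ H.dist r a' = d ∧ H.Adj a' a := by
    intro d a ha hd
    obtain ⟨q, hq⟩ := ha.symm.exists_walk_length_eq_dist
    rw [SimpleGraph.dist_comm, hd] at hq
    cases q with
    | nil => simp at hq
    | @cons _ a' _ hadj q' =>
      rw [SimpleGraph.Walk.length_cons] at hq
      have h1 : H.dist r a' ≤ d := by
        rw [SimpleGraph.dist_comm]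
        exact (SimpleGraph.dist_le q').trans (by omega)
      have hr : H.Reachable r a' := q'.reachable.symm
      refine ⟨a', hr, ?_, hadj.symm⟩
      obtain ⟨q'', hq''⟩ := hr.exists_walk_length_eq_dist
      have := SimpleGraph.dist_le (q''.concat hadj.symm)
      rw [SimpleGraph.Walk.length_concat] at this
      omega
  induction d with
  | zero =>
    intro a b c ha hb _ h1 h2 _
    exact Or.inl ((ha.dist_eq_zero_iff.1 h1).symm.trans (hb.dist_eq_zero_iff.1 h2))
  | succ d ih =>
    intro a b c ha hb hc h1 h2 h3
    obtain ⟨a', ra, da, ea⟩ := pred d a ha h1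
    obtain ⟨b', rb, db, eb⟩ := pred d b hb h2
    obtain ⟨c', rc, dc, ec⟩ := pred d c hc h3
    cases d with
    | zero =>
      have h1 := ra.dist_eq_zero_iff.1 da
      have h2 := rb.dist_eq_zero_iff.1 db
      have h3 := rc.dist_eq_zero_iff.1 dc
      subst h1
      subst h2
      subst h3
      exact hdeg r a b c ea eb ec
    | succ d =>
      -- Away from the root, one of the at most two neighbours of `z` lies in the previous layer, so
      -- at most one lies in the next.
      have two : ∀ x y z, H.Adj z x → H.Adj z y → H.Reachable r z → H.dist r z = d + 1 →
          H.dist r x = d + 1 + 1 → H.dist r y = d + 1 + 1 → x = y := by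
        intro x y z hx hy rz dz dx dy
        obtain ⟨z', _, dz', ez⟩ := pred d z rz dz
        rcases hdeg z x y z' hx hy ez.symm with h | h | h
        · exact h
        · subst h; omega
        · subst h; omega
      rcases ih a' b' c' ra rb rc da db dc with h | h | h
      · subst h; exact Or.inl (two _ _ _ ea eb ra da h1 h2)
      · subst h; exact Or.inr (Or.inl (two _ _ _ eb ec rb db h2 h3))
      · subst h; exact Or.inr (Or.inr (two _ _ _ ea ec ra da h1 h3))

/-- Deleting a light set of vertices from a graph of maximum degree two leaves only components
with at most `k` vertices. -/
theorem SimpleGraph.exists_light_deletion {α : Type*} (H : SimpleGraph α)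
    (hdeg : ∀ v a b c, H.Adj v a → H.Adj v b → H.Adj v c → a = b ∨ b = c ∨ a = c)
    (S : Finset α) (w : α → ℝ) (hw : ∀ a ∈ S, 0 ≤ w a) (k : ℕ) :
    ∃ N ⊆ S, (1 - 2 / (k + 1)) * ∑ a ∈ S, w a ≤ ∑ a ∈ N, w a ∧
      ∃ φ : α → H.ConnectedComponent × ℕ,
        (∀ a ∈ N, ∀ b ∈ N, H.Adj a b → φ a = φ b) ∧
        ∀ t, ∀ F ⊆ N, (∀ a ∈ F, φ a = t) → F.card ≤ k := by
  classical
  -- This `m` serves both bounds: a lightest residue class has weight at most 1/m ≤ 2/(k+1) of the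
  -- total, and the m - 1 layers between deleted ones hold at most 2(m - 1) ≤ k elements.
  set m := k / 2 + 1 with hm
  let lev : α → ℕ := fun a => H.dist (H.connectedComponentMk a).out a
  have hroot : ∀ a, H.Reachable (H.connectedComponentMk a).out a := fun a =>
    SimpleGraph.ConnectedComponent.exact (Quot.out_eq _)
  have havg : ∃ j ∈ Finset.range m,
      ∑ a ∈ S with m ∣ lev a + j, w a ≤ (∑ a ∈ S, w a) / m := by
    have htot : ∑ j ∈ Finset.range m, ∑ a ∈ S with m ∣ lev a + j, w a = ∑ a ∈ S, w a := by
      simp_rw [Finset.sum_filter]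
      rw [Finset.sum_comm]
      refine Finset.sum_congr rfl fun a _ => ?_
      have hlt := Nat.mod_lt (lev a) (show 0 < m by omega)
      have h0 : m ∣ lev a + (m - lev a % m) % m := by
        refine Nat.dvd_of_mod_eq_zero ?_
        rw [Nat.add_mod, Nat.mod_mod, ← Nat.add_mod, Nat.add_mod]
        rcases Nat.eq_zero_or_pos (lev a % m) with h | h
        · simp [h]
        · rw [Nat.mod_eq_of_lt (show m - lev a % m < m by omega)]
          rw [show lev a % m + (m - lev a % m) = m by omega, Nat.mod_self]
      rw [Finset.sum_eq_single_of_mem ((m - lev a % m) % m)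
        (Finset.mem_range.2 (Nat.mod_lt _ (by omega)))]
      · rw [if_pos h0]
      · intro b hb hne
        rw [if_neg]
        intro hdvd
        apply hne
        have hmod : lev a + b ≡ lev a + (m - lev a % m) % m [MOD m] :=
          (Nat.modEq_zero_iff_dvd.2 hdvd).trans (Nat.modEq_zero_iff_dvd.2 h0).symm
        exact (Nat.ModEq.add_left_cancel' _ hmod).eq_of_lt_of_lt (Finset.mem_range.1 hb)
          (Nat.mod_lt _ (by omega))
    refine Finset.exists_le_of_sum_le ⟨0, Finset.mem_range.2 (by omega)⟩ ?_
    rw [htot, Finset.sum_const, Finset.card_range, nsmul_eq_mul]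
    rw [mul_div_cancel₀]
    exact_mod_cast (show m ≠ 0 by omega)
  obtain ⟨j, -, hj⟩ := havg
  refine ⟨S.filter fun a => ¬ m ∣ lev a + j, Finset.filter_subset _ _, ?_,
    fun a => (H.connectedComponentMk a, (lev a + j) / m), ?_, ?_⟩
  · have hsum := Finset.sum_filter_add_sum_filter_not S (fun a => m ∣ lev a + j) w
    have hS : 0 ≤ ∑ a ∈ S, w a := Finset.sum_nonneg hw
    have hm2 : ((k : ℝ) + 1) / 2 ≤ m := by
      have : k + 1 ≤ 2 * m := by omega
      have : ((k : ℝ) + 1) ≤ 2 * m := by exact_mod_cast this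
      linarith
    have : (∑ a ∈ S, w a) / m ≤ 2 / (k + 1) * ∑ a ∈ S, w a := by
      calc _ ≤ (∑ a ∈ S, w a) / (((k : ℝ) + 1) / 2) :=
            div_le_div_of_nonneg_left hS (by positivity) hm2
        _ = _ := by field_simp
    linarith
  · intro a ha b hb hab
    have hc : H.connectedComponentMk a = H.connectedComponentMk b :=
      SimpleGraph.ConnectedComponent.sound hab.reachable
    have ha' := (Finset.mem_filter.1 ha).2
    have hb' := (Finset.mem_filter.1 hb).2
    refine Prod.ext hc ?_
    have hdist := hab.diff_dist_adj (u := (H.connectedComponentMk a).out)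
    have hlb : H.dist (H.connectedComponentMk a).out b = lev b := by rw [hc]
    rw [hlb] at hdist
    change lev b = lev a ∨ lev b = lev a + 1 ∨ lev b = lev a - 1 at hdist
    -- Levels of neighbours differ by at most one, and the block index only changes on entering a
    -- multiple of `m`, which has been deleted.
    have step : ∀ x : ℕ, ¬ m ∣ x + 1 → x / m = (x + 1) / m := by
      intro x hx
      rw [Nat.succ_div, if_neg hx, add_zero]
    change (lev a + j) / m = (lev b + j) / m
    rcases hdist with h | h | h
    · rw [h]
    · rw [show lev b + j = lev a + j + 1 by omega] at hb' ⊢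
      exact step _ hb'
    · rcases Nat.eq_zero_or_pos (lev a) with h0 | h0
      · rw [h, h0]
      · rw [show lev a + j = lev b + j + 1 by omega] at ha' ⊢
        exact (step _ ha').symm
  · rintro ⟨c, t⟩ F hFN hFt
    have hmemF : ∀ a ∈ F, ¬ m ∣ lev a + j ∧ H.connectedComponentMk a = c ∧ (lev a + j) / m = t :=
      fun a ha => ⟨(Finset.mem_filter.1 (hFN ha)).2, Prod.ext_iff.1 (hFt a ha)⟩
    -- Component, block index and residue together determine the distance layer, so each residue
    -- occurs at most twice in `F`.
    have h1 : F.card ≤ 2 * (F.image fun a => (lev a + j) % m).card := by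
      refine Finset.card_le_mul_card_image F 2 fun r _ => ?_
      by_contra hcon
      rw [not_le, Finset.two_lt_card] at hcon
      obtain ⟨a, ha, b, hb, d, hd, hab, had, hbd⟩ := hcon
      have hlev : ∀ x ∈ F.filter (fun a => (lev a + j) % m = r),
          H.Reachable c.out x ∧ H.dist c.out x = m * t + r - j := by
        intro x hx
        obtain ⟨hxF, hxr⟩ := Finset.mem_filter.1 hx
        obtain ⟨-, hxc, hxt⟩ := hmemF x hxF
        subst hxc
        refine ⟨hroot x, ?_⟩
        have := Nat.div_add_mod (lev x + j) m
        rw [hxt, hxr] at this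
        change lev x = _
        omega
      obtain ⟨ra, da⟩ := hlev a ha
      obtain ⟨rb, db⟩ := hlev b hb
      obtain ⟨rd, dd⟩ := hlev d hd
      rcases H.layer_le_two hdeg c.out _ a b d ra rb rd da db dd with h | h | h <;> contradiction
    have h2 : (F.image fun a => (lev a + j) % m) ⊆ Finset.Ioo 0 m := by
      intro r hr
      obtain ⟨a, ha, rfl⟩ := Finset.mem_image.1 hr
      rw [Finset.mem_Ioo]
      refine ⟨Nat.pos_of_ne_zero fun h => (hmemF a ha).1 (Nat.dvd_of_mod_eq_zero h),
        Nat.mod_lt _ (by omega)⟩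
    have h3 := Finset.card_le_card h2
    rw [Nat.card_Ioo] at h3
    omega

/-- In a finite graph of maximum degree two, the edges of a connected component form a path or a
cycle. -/
theorem SimpleGraph.exists_path_or_cycle_of_component {V : Type*} [Fintype V]
    (K : SimpleGraph V)
    (hdeg : ∀ v a b c, K.Adj v a → K.Adj v b → K.Adj v c → a = b ∨ b = c ∨ a = c) (x : V) :
    (∃ (u v : V) (q : K.Walk u v), q.IsPath ∧
        ∀ e, e ∈ q.edges ↔ e ∈ K.edgeSet ∧ ∃ y ∈ e, K.Reachable x y) ∨
      ∃ (u : V) (q : K.Walk u u), q.IsCycle ∧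
        ∀ e, e ∈ q.edges ↔ e ∈ K.edgeSet ∧ ∃ y ∈ e, K.Reachable x y := by
  classical
  -- Take a longest path in the component of `x`. By maximality its endpoints have no neighbour off
  -- it; its interior vertices have both neighbours along it by the degree bound.
  obtain ⟨u, v, q, hxu, hq, hmax⟩ : ∃ (u v : V) (q : K.Walk u v), K.Reachable x u ∧ q.IsPath ∧
      ∀ (u' v' : V) (q' : K.Walk u' v'), K.Reachable x u' → q'.IsPath → q'.length ≤ q.length := by
    let S : Set ℕ := {n | ∃ (u v : V) (q : K.Walk u v), K.Reachable x u ∧ q.IsPath ∧ q.length = n}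
    have hne : S.Nonempty := ⟨0, x, x, .nil, .refl x, .nil, rfl⟩
    have hbdd : BddAbove S := by
      refine ⟨Fintype.card V, ?_⟩
      rintro n ⟨u, v, q, -, hq, rfl⟩
      exact hq.length_lt.le
    obtain ⟨u, v, q, h1, h2, h3⟩ := Nat.sSup_mem hne hbdd
    exact ⟨u, v, q, h1, h2, fun u' v' q' h1' h2' =>
      h3 ▸ le_csSup hbdd ⟨u', v', q', h1', h2', rfl⟩⟩
  have hv : ∀ y, K.Adj v y → y ∈ q.support := by
    intro y hy
    by_contra hcon
    have := hmax _ _ _ hxu (hq.concat hcon hy)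
    rw [SimpleGraph.Walk.length_concat] at this
    omega
  have hu : ∀ y, K.Adj u y → y ∈ q.support := by
    intro y hy
    by_contra hcon
    have := hmax _ _ (SimpleGraph.Walk.cons hy.symm q) (hxu.trans hy.reachable)
      (hq.cons hcon)
    rw [SimpleGraph.Walk.length_cons] at this
    omega
  have hint : ∀ a ∈ q.support, a ≠ u → a ≠ v → ∀ y, K.Adj a y → s(a, y) ∈ q.edges := by
    intro a ha hau hav y hy
    obtain ⟨i, rfl, hi⟩ := SimpleGraph.Walk.mem_support_iff_exists_getVert.1 ha
    have hi0 : i ≠ 0 := by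
      rintro rfl
      exact hau q.getVert_zero
    have hil : i ≠ q.length := by
      rintro rfl
      exact hav q.getVert_length
    obtain ⟨i, rfl⟩ := Nat.exists_eq_succ_of_ne_zero hi0
    have e1 : s(q.getVert i, q.getVert (i + 1)) ∈ q.edges :=
      (SimpleGraph.Walk.mk_mem_edges_iff_exists q).2 ⟨_, by omega, rfl⟩
    have e2 : s(q.getVert (i + 1), q.getVert (i + 1 + 1)) ∈ q.edges :=
      (SimpleGraph.Walk.mk_mem_edges_iff_exists q).2 ⟨_, by omega, rfl⟩
    have a1 := q.adj_getVert_succ (i := i) (by omega)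
    have a2 := q.adj_getVert_succ (i := i + 1) (by omega)
    rcases hdeg _ _ _ _ a1.symm a2 hy with h | h | h
    · have := hq.getVert_injOn (by simp only [Set.mem_ofPred_eq]; omega)
        (by simp only [Set.mem_ofPred_eq]; omega) h
      omega
    · rw [← h]; exact e2
    · rw [← h, Sym2.eq_swap]; exact e1
  -- The only possible edge at the path that is not on it joins its two endpoints; this edge decides
  -- between path and cycle.
  have key : ∀ a ∈ q.support, ∀ y, K.Adj a y → s(a, y) ∈ q.edges ∨ s(a, y) = s(v, u) := by
    intro a ha y hy
    by_cases h : s(a, y) ∈ q.edges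
    · exact Or.inl h
    have haend : a = u ∨ a = v := by
      by_contra hcon
      rw [not_or] at hcon
      exact h (hint a ha hcon.1 hcon.2 y hy)
    have hys : y ∈ q.support := by
      rcases haend with rfl | rfl
      · exact hu y hy
      · exact hv y hy
    have hyend : y = u ∨ y = v := by
      by_contra hcon
      rw [not_or] at hcon
      exact h (Sym2.eq_swap ▸ hint y hys hcon.1 hcon.2 a hy.symm)
    have := hy.ne
    rcases haend with rfl | rfl <;> rcases hyend with rfl | rfl
    · contradiction
    · exact Or.inr Sym2.eq_swap
    · exact Or.inr rfl
    · contradiction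
  have hclosed : ∀ y, K.Reachable x y ↔ y ∈ q.support := by
    have hs : ∀ a ∈ q.support, ∀ y, K.Adj a y → y ∈ q.support := by
      intro a ha y hy
      rcases key a ha y hy with h | h
      · exact q.snd_mem_support_of_mem_edges h
      · have : y ∈ s(v, u) := h ▸ Sym2.mem_mk_right a y
        rcases Sym2.mem_iff.1 this with rfl | rfl
        · exact q.end_mem_support
        · exact q.start_mem_support
    have hreach : ∀ a b, ∀ r : K.Walk a b, a ∈ q.support → b ∈ q.support := by
      intro a b r
      induction r with
      | nil => exact id
      | cons h r ih => exact fun ha => ih (hs _ ha _ h)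
    intro y
    constructor
    · intro hy
      obtain ⟨r⟩ := hxu.symm.trans hy
      exact hreach _ _ r q.start_mem_support
    · intro hy
      exact hxu.trans ⟨q.takeUntil y hy⟩
  by_cases hvu : K.Adj v u ∧ s(v, u) ∉ q.edges
  · right
    refine ⟨v, SimpleGraph.Walk.cons hvu.1 q,
      (SimpleGraph.Walk.cons_isCycle_iff _ _).2 ⟨hq, hvu.2⟩, ?_⟩
    intro e
    rw [SimpleGraph.Walk.edges_cons, List.mem_cons]
    induction e with
    | h a b =>
      constructor
      · rintro (h | h)
        · rw [h]
          exact ⟨hvu.1, v, Sym2.mem_mk_left _ _, (hclosed v).2 q.end_mem_support⟩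
        · exact ⟨q.edges_subset_edgeSet h, a, Sym2.mem_mk_left _ _,
            (hclosed a).2 (q.fst_mem_support_of_mem_edges h)⟩
      · rintro ⟨hab, y, hy, hxy⟩
        rw [hclosed] at hxy
        rcases Sym2.mem_iff.1 hy with rfl | rfl
        · exact (key _ hxy _ hab).symm
        · rw [Sym2.eq_swap]
          exact (key _ hxy _ (SimpleGraph.Adj.symm hab)).symm
  · left
    refine ⟨u, v, q, hq, ?_⟩
    have key' : ∀ a ∈ q.support, ∀ y, K.Adj a y → s(a, y) ∈ q.edges := by
      intro a ha y hy
      rcases key a ha y hy with h | h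
      · exact h
      · by_contra hcon
        refine hvu ⟨?_, h ▸ hcon⟩
        rw [← SimpleGraph.mem_edgeSet, ← h]
        exact hy
    intro e
    induction e with
    | h a b =>
      constructor
      · intro h
        exact ⟨q.edges_subset_edgeSet h, a, Sym2.mem_mk_left _ _,
          (hclosed a).2 (q.fst_mem_support_of_mem_edges h)⟩
      · rintro ⟨hab, y, hy, hxy⟩
        rw [hclosed] at hxy
        rcases Sym2.mem_iff.1 hy with rfl | rfl
        · exact key' _ hxy _ hab
        · rw [Sym2.eq_swap]
          exact key' _ hxy _ (SimpleGraph.Adj.symm hab)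

/-! ### Matchings, gains and augmentations -/

namespace WeightedMatching

universe u

variable {V : Type u} [Fintype V] [DecidableEq V]

/-- The vertices covered by an edge set. -/
def verts (p : Finset (Sym2 V)) : Finset V := Finset.univ.filter fun v => ∃ e ∈ p, v ∈ e

lemma mem_verts {p : Finset (Sym2 V)} {v : V} : v ∈ verts p ↔ ∃ e ∈ p, v ∈ e := by
  simp [verts]

lemma disjoint_of_disjoint_verts {p q : Finset (Sym2 V)} (h : Disjoint (verts p) (verts q)) :
    Disjoint p q := by
  rw [Finset.disjoint_left]
  intro e hp hq
  induction e with
  | h a b =>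
    exact Finset.disjoint_left.1 h (mem_verts.2 ⟨_, hp, Sym2.mem_mk_left a b⟩)
      (mem_verts.2 ⟨_, hq, Sym2.mem_mk_left a b⟩)

section Matching

variable {G : SimpleGraph V} {M : Finset (Sym2 V)}

lemma IsMatching.eq_of_mem (h : IsMatching G M) {e f : Sym2 V} {v : V} (he : e ∈ M) (hf : f ∈ M)
    (hve : v ∈ e) (hvf : v ∈ f) : e = f := by
  by_contra hne
  exact h.2 e he f hf hne ⟨v, hve, hvf⟩

lemma isMatching_empty (G : SimpleGraph V) : IsMatching G ∅ := by
  simp [IsMatching]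

lemma IsMatching.mono {N : Finset (Sym2 V)} (h : IsMatching G M) (hN : N ⊆ M) : IsMatching G N :=
  ⟨fun e he => h.1 e (hN he), fun e he f hf => h.2 e (hN he) f (hN hf)⟩

/-- Being a matching is a local condition. -/
lemma isMatching_of_local (h : ∀ v, ∃ M', IsMatching G M' ∧ ∀ e ∈ M, v ∈ e → e ∈ M') :
    IsMatching G M := by
  constructor
  · intro e he
    induction e with
    | h a b =>
      obtain ⟨M', hM', h'⟩ := h a
      exact hM'.1 _ (h' _ he (Sym2.mem_mk_left a b))
  · rintro e he f hf hne ⟨v, hve, hvf⟩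
    obtain ⟨M', hM', h'⟩ := h v
    exact hne (hM'.eq_of_mem (h' e he hve) (h' f hf hvf) hve hvf)

lemma IsMatching.two_mul_card_le (h : IsMatching G M) {X : Finset V}
    (hX : ∀ e ∈ M, ∀ v ∈ e, v ∈ X) : 2 * M.card ≤ X.card := by
  have h1 : M.biUnion (fun e => e.toFinset) ⊆ X := by
    intro v hv
    obtain ⟨e, he, hve⟩ := Finset.mem_biUnion.1 hv
    exact hX e he v (Sym2.mem_toFinset.1 hve)
  have h2 : (M.biUnion (fun e => e.toFinset)).card = ∑ e ∈ M, e.toFinset.card := by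
    refine Finset.card_biUnion fun e he f hf hne => ?_
    refine Finset.disjoint_left.2 fun v hve hvf => ?_
    exact h.2 e he f hf hne ⟨v, Sym2.mem_toFinset.1 hve, Sym2.mem_toFinset.1 hvf⟩
  have h3 : ∑ e ∈ M, e.toFinset.card = ∑ _e ∈ M, 2 := by
    refine Finset.sum_congr rfl fun e he => Sym2.card_toFinset_of_not_isDiag e ?_
    exact G.not_isDiag_of_mem_edgeSet (h.1 e he)
  rw [Finset.sum_const, smul_eq_mul] at h3
  have := Finset.card_le_card h1
  omega

end Matching

section Gain

variable (w : Sym2 V → ℝ)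

/-- As a signed sum over the edges of `p`, the gain is visibly additive over disjoint unions. -/
lemma gain_eq_sum (M p : Finset (Sym2 V)) :
    gain w M p = ∑ e ∈ p, if e ∈ M then -w e else w e := by
  rw [gain, weight, weight, Finset.sum_ite, ← Finset.filter_notMem_eq_sdiff,
    ← Finset.filter_mem_eq_inter, Finset.sum_neg_distrib]
  ring

lemma gain_biUnion {ι : Type*} (M : Finset (Sym2 V)) (F : Finset ι)
    (f : ι → Finset (Sym2 V)) (hF : ∀ p ∈ F, ∀ q ∈ F, p ≠ q → Disjoint (f p) (f q)) :
    gain w M (F.biUnion f) = ∑ p ∈ F, gain w M (f p) := by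
  simp only [gain_eq_sum]
  exact Finset.sum_biUnion hF

lemma weight_symmDiff (M p : Finset (Sym2 V)) :
    weight w (M ∆ p) = weight w M + gain w M p := by
  have h1 : weight w (M ∆ p) = weight w (M \ p) + weight w (p \ M) := by
    rw [weight, weight, weight, symmDiff_def, Finset.sup_eq_union, Finset.sum_union]
    exact disjoint_sdiff_sdiff
  have h2 : weight w M = weight w (M \ p) + weight w (p ∩ M) := by
    rw [weight, weight, weight, Finset.inter_comm, add_comm, Finset.sum_inter_add_sum_sdiff]
  rw [h1, h2, gain]
  ring

lemma gain_congr {M M' p : Finset (Sym2 V)} (h : ∀ e ∈ p, e ∈ M ↔ e ∈ M') :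
    gain w M p = gain w M' p := by
  rw [gain_eq_sum, gain_eq_sum]
  exact Finset.sum_congr rfl fun e he => by simp only [h e he]

end Gain

lemma IsSimplePathOrCycle.card_verts_le {G : SimpleGraph V} {p : Finset (Sym2 V)}
    (h : IsSimplePathOrCycle G p) : (verts p).card ≤ p.card + 1 := by
  have main : ∀ {u v : V} (q : G.Walk u v), q.IsTrail →
      (verts q.edges.toFinset).card ≤ q.edges.toFinset.card + 1 := by
    intro u v q hq
    have h1 : verts q.edges.toFinset ⊆ q.support.toFinset := by
      intro x hx
      obtain ⟨e, he, hxe⟩ := mem_verts.1 hx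
      exact List.mem_toFinset.2 (q.mem_support_of_mem_edges (List.mem_toFinset.1 he) hxe)
    rw [List.toFinset_card_of_nodup hq.edges_nodup, q.length_edges, ← q.length_support]
    exact (Finset.card_le_card h1).trans (List.toFinset_card_le _)
  rcases h with ⟨u, v, q, hq, rfl⟩ | ⟨u, q, hq, rfl⟩
  · exact main q hq.isTrail
  · exact main q hq.isTrail

section Augmenting

variable {G : SimpleGraph V} {w : Sym2 V → ℝ} {k : ℕ} {M p : Finset (Sym2 V)}

lemma IsAugmenting.nonempty (h : IsAugmenting G w M p) : p.Nonempty := by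
  rw [Finset.nonempty_iff_ne_empty]
  rintro rfl
  have := h.2.2.2
  simp [gain, weight] at this

lemma IsAugmenting.verts_nonempty (h : IsAugmenting G w M p) : (verts p).Nonempty := by
  obtain ⟨e, he⟩ := h.nonempty
  induction e with
  | h a b => exact ⟨a, mem_verts.2 ⟨_, he, Sym2.mem_mk_left a b⟩⟩

/-- The edges of `p ∩ M` cover twice their number of vertices, while a path or cycle has at most one
vertex more than edges. Hence at most k edges outside `M` give at most 2k+1 edges and 2k+2 vertices
in all. -/
lemma IsAugmenting.card_inter_le (h : IsAugmenting G w M p) (hM : IsMatching G M) :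
    (p ∩ M).card ≤ (p \ M).card + 1 := by
  have h1 := h.1.card_verts_le
  have h2 : 2 * (p ∩ M).card ≤ (verts p).card :=
    (hM.mono Finset.inter_subset_right).two_mul_card_le fun e he v hv =>
      mem_verts.2 ⟨e, (Finset.mem_inter.1 he).1, hv⟩
  have h3 := Finset.card_inter_add_card_sdiff p M
  omega

lemma IsBoundedAugmenting.card_verts_le (h : IsBoundedAugmenting G w k M p)
    (hM : IsMatching G M) : (verts p).card ≤ 2 * k + 2 := by
  have h1 := h.1.1.card_verts_le
  have h2 := h.1.card_inter_le hM
  have h3 := Finset.card_inter_add_card_sdiff p M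
  have h4 := h.2
  omega

/-- Augmenting paths only see the matching edges at their own vertices. -/
lemma IsBoundedAugmenting.congr {M' : Finset (Sym2 V)} (h : IsBoundedAugmenting G w k M p)
    (hM' : IsMatching G M') (hMM' : ∀ v ∈ verts p, ∀ e, v ∈ e → (e ∈ M ↔ e ∈ M')) :
    IsBoundedAugmenting G w k M' p ∧ gain w M' p = gain w M p := by
  have hp : ∀ e ∈ p, e ∈ M ↔ e ∈ M' := by
    intro e he
    induction e with
    | h a b =>
      exact hMM' a (mem_verts.2 ⟨_, he, Sym2.mem_mk_left a b⟩) _ (Sym2.mem_mk_left a b)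
  have hg : gain w M' p = gain w M p := gain_congr w fun e he => (hp e he).symm
  obtain ⟨⟨h1, h2, h3, h4⟩, h5⟩ := h
  refine ⟨⟨⟨h1, ?_, ?_, hg ▸ h4⟩, ?_⟩, hg⟩
  · intro e he f hf hne hv
    rw [← hp e he, ← hp f hf]
    exact h2 e he f hf hne hv
  · refine isMatching_of_local fun v => ?_
    by_cases hv : v ∈ verts p
    · refine ⟨_, h3, fun e he hve => ?_⟩
      rw [Finset.mem_symmDiff] at he ⊢
      rwa [hMM' v hv e hve]
    · refine ⟨_, hM', fun e he hve => ?_⟩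
      rw [Finset.mem_symmDiff] at he
      exact he.elim (fun h => h.1) fun h => absurd (mem_verts.2 ⟨e, h.1, hve⟩) hv
  · have : p \ M' = p \ M := by
      ext e
      simp only [Finset.mem_sdiff]
      exact and_congr_right fun he => by rw [hp e he]
    rwa [this]

/-- Each vertex meets at most one of the sets, so around it the result looks like `M ∆ f p` for a
single `p`, or like `M`. -/
lemma isMatching_symmDiff_biUnion {ι : Type*} (hM : IsMatching G M) (F : Finset ι)
    (f : ι → Finset (Sym2 V)) (hf : ∀ p ∈ F, IsMatching G (M ∆ f p))
    (hF : ∀ p ∈ F, ∀ q ∈ F, p ≠ q → Disjoint (verts (f p)) (verts (f q))) :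
    IsMatching G (M ∆ F.biUnion f) := by
  refine isMatching_of_local fun v => ?_
  by_cases hv : ∃ p ∈ F, v ∈ verts (f p)
  · obtain ⟨p, hp, hvp⟩ := hv
    refine ⟨_, hf p hp, fun e he hve => ?_⟩
    have key : e ∈ F.biUnion f ↔ e ∈ f p := by
      refine ⟨fun h => ?_, fun h => Finset.mem_biUnion.2 ⟨p, hp, h⟩⟩
      obtain ⟨q, hq, heq⟩ := Finset.mem_biUnion.1 h
      by_cases hpq : p = q
      · rwa [hpq]
      · exact absurd (mem_verts.2 ⟨e, heq, hve⟩) (Finset.disjoint_left.1 (hF p hp q hq hpq) hvp)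
    rw [Finset.mem_symmDiff] at he ⊢
    rwa [← key]
  · refine ⟨_, hM, fun e he hve => ?_⟩
    rw [Finset.mem_symmDiff] at he
    refine he.elim (fun h => h.1) fun h => ?_
    obtain ⟨q, hq, heq⟩ := Finset.mem_biUnion.1 h.1
    exact absurd ⟨q, hq, mem_verts.2 ⟨e, heq, hve⟩⟩ hv

end Augmenting

/-! ### Progress of one step and of one phase -/

section Step

variable {G : SimpleGraph V} {w : Sym2 V → ℝ} {k : ℕ} {γ : ℝ} {M M' : Finset (Sym2 V)}

lemma exists_augStep (G : SimpleGraph V) (w : Sym2 V → ℝ) (k : ℕ) (γ : ℝ)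
    (M : Finset (Sym2 V)) : ∃ M', AugStep G w k γ M M' := by
  classical
  obtain ⟨S, -, hS⟩ := Finite.exists_le_maximal
    (p := fun I => (intersectionGraph (augPaths G w k M γ)).IsIndepSet I) (a := ∅)
    (by simp [SimpleGraph.IsIndepSet])
  have hfin : S.Finite := Set.toFinite S
  refine ⟨_, hfin.toFinset, ?_, rfl⟩
  rw [Set.Finite.coe_toFinset]
  exact hS

/-- What one step does: the augmented set of vertices `Y` meets every available path, and each
unit of gain pays for at most `2k + 2` vertices. -/
lemma AugStep.spec (hM : IsMatching G M) (h : AugStep G w k γ M M') :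
    IsMatching G M' ∧ ∃ (Y : Finset V) (s : ℕ), Y.card ≤ s * (2 * k + 2) ∧
      weight w M' = weight w M + s * γ ∧ (0 < s → 0 < γ) ∧
      (∀ e : Sym2 V, ∀ v ∈ e, v ∉ Y → (e ∈ M ↔ e ∈ M')) ∧
      ∀ p ∈ augPaths G w k M γ, ¬ Disjoint (verts p) Y := by
  obtain ⟨S, hS, rfl⟩ := h
  have hdisj : ∀ p ∈ S, ∀ q ∈ S, p ≠ q → Disjoint (verts p.1) (verts q.1) := by
    intro p hp q hq hpq
    rw [Finset.disjoint_left]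
    intro v hvp hvq
    exact hS.prop hp hq hpq ⟨hpq, v, mem_verts.1 hvp, mem_verts.1 hvq⟩
  refine ⟨isMatching_symmDiff_biUnion hM S _ (fun p _ => p.2.1.1.2.2.1) hdisj,
    S.biUnion fun p => verts p.1, S.card, ?_, ?_, ?_, ?_, ?_⟩
  · exact Finset.card_biUnion_le_card_mul _ _ _ fun p _ => p.2.1.card_verts_le hM
  · rw [weight_symmDiff, gain_biUnion w M S _ fun p hp q hq hpq =>
      disjoint_of_disjoint_verts (hdisj p hp q hq hpq), Finset.sum_congr rfl fun p _ => p.2.2,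
      Finset.sum_const, nsmul_eq_mul]
  · intro hs
    obtain ⟨p, -⟩ := Finset.card_pos.1 hs
    exact p.2.2 ▸ p.2.1.1.2.2.2
  · intro e v hve hv
    have : e ∉ S.biUnion fun p => p.1 := by
      intro he
      obtain ⟨p, hp, hep⟩ := Finset.mem_biUnion.1 he
      exact hv (Finset.mem_biUnion.2 ⟨p, hp, mem_verts.2 ⟨e, hep, hve⟩⟩)
    simp [Finset.mem_symmDiff, this]
  · intro p hp hd
    have hnot : ∀ q ∈ S, Disjoint (verts p) (verts q.1) := fun q hq =>
      hd.mono_right (Finset.subset_biUnion_of_mem (fun q : augPaths G w k M γ => verts q.1) hq)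
    have hins : (intersectionGraph (augPaths G w k M γ)).IsIndepSet
        (insert ⟨p, hp⟩ (S : Set (augPaths G w k M γ))) := by
      refine hS.prop.insert fun q hq _ => ?_
      have : ∀ v, v ∈ verts p → v ∉ verts q.1 := fun v hv =>
        Finset.disjoint_left.1 (hnot q hq) hv
      constructor
      · rintro ⟨-, v, h1, h2⟩
        exact this v (mem_verts.2 h1) (mem_verts.2 h2)
      · rintro ⟨-, v, h1, h2⟩
        exact this v (mem_verts.2 h2) (mem_verts.2 h1)
    -- By maximality a path avoiding all chosen ones would itself be chosen, and then its nonempty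
    -- vertex set would be disjoint from itself.
    have hmem : (⟨p, hp⟩ : augPaths G w k M γ) ∈ S :=
      hS.le_of_ge hins (Set.subset_insert _ _) (Set.mem_insert _ _)
    obtain ⟨v, hv⟩ := hp.1.1.verts_nonempty
    exact Finset.disjoint_left.1 (hnot _ hmem) hv hv

lemma exists_phase (G : SimpleGraph V) (w : Sym2 V → ℝ) (k : ℕ) {T : ℕ} (g : Fin T → ℝ)
    (M : Finset (Sym2 V)) : ∃ M', Phase G w k g M M' := by
  choose f hf using fun γ M => exists_augStep G w k γ M
  let N : ℕ → Finset (Sym2 V) := fun j =>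
    Nat.rec M (fun j X => if h : j < T then f (g ⟨j, h⟩) X else X) j
  refine ⟨N T, N, rfl, fun j => ?_, rfl⟩
  have : N ((j : ℕ) + 1) = f (g j) (N j) := by simp [N]
  rw [this]
  exact hf _ _

lemma exists_isOutput (G : SimpleGraph V) (w : Sym2 V → ℝ) (k L : ℕ) {T : ℕ} (g : Fin T → ℝ) :
    ∃ M, IsOutput G w k L g M := by
  choose f hf using fun M => exists_phase G w k g M
  exact ⟨_, fun i => Nat.rec ∅ (fun _ X => f X) i, rfl, fun i _ => hf _, rfl⟩

/-- A phase gains at least a `1 / (2k + 2)` fraction of any vertex-disjoint family of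
augmentations that is available at its start. -/
theorem Phase.weight_ge {T : ℕ} {g : Fin T → ℝ} (hg : StrictAnti g)
    (hgains : possibleGains G w k ⊆ Set.range g) (hM : IsMatching G M) (h : Phase G w k g M M')
    (A : Finset (Finset (Sym2 V))) (hA : ∀ p ∈ A, IsBoundedAugmenting G w k M p)
    (hdisj : ∀ p ∈ A, ∀ q ∈ A, p ≠ q → Disjoint (verts p) (verts q)) :
    IsMatching G M' ∧
      weight w M + (∑ p ∈ A, gain w M p) / (2 * k + 2) ≤ weight w M' := by
  classical
  obtain ⟨N, h0, hstep, rfl⟩ := h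
  -- Here `X` collects the vertices touched so far. Off `X` the matching is unchanged, the members
  -- of `A` meeting `X` are already paid for, and every member whose gain has been processed meets
  -- `X`.
  have key : ∀ j ≤ T, IsMatching G (N j) ∧ ∃ X : Finset V,
      (∀ e : Sym2 V, ∀ v ∈ e, v ∉ X → (e ∈ M ↔ e ∈ N j)) ∧
      (weight w M + (∑ p ∈ A with ¬ Disjoint (verts p) X, gain w M p) / (2 * k + 2) ≤
        weight w (N j)) ∧
      ∀ p ∈ A, ∀ i : Fin T, (i : ℕ) < j → gain w M p = g i → ¬ Disjoint (verts p) X := by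
    intro j
    induction j with
    | zero =>
      intro _
      rw [h0]
      exact ⟨hM, ∅, by simp, by simp, fun p _ i hi => absurd hi (Nat.not_lt_zero _)⟩
    | succ j ih =>
      intro hj
      obtain ⟨hNj, X, hX, hwt, hdone⟩ := ih (by omega)
      obtain ⟨hN', Y, s, hYs, hws, hsγ, hY, hmeet⟩ := (hstep ⟨j, hj⟩).spec hNj
      simp only at hN' hYs hws hsγ hY hmeet
      refine ⟨hN', X ∪ Y, ?_, ?_, ?_⟩
      · intro e v hve hv
        rw [Finset.mem_union, not_or] at hv
        rw [hX e v hve hv.1, hY e v hve hv.2]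
      · set γ := g ⟨j, hj⟩ with hγ
        set B := A.filter fun p => Disjoint (verts p) X ∧ ¬ Disjoint (verts p) Y with hB
        have hsplit : A.filter (fun p => ¬ Disjoint (verts p) (X ∪ Y)) =
            A.filter (fun p => ¬ Disjoint (verts p) X) ∪ B := by
          ext p
          simp only [hB, Finset.mem_filter, Finset.mem_union, Finset.disjoint_union_right]
          tauto
        have hdis : Disjoint (A.filter (fun p => ¬ Disjoint (verts p) X)) B := by
          rw [Finset.disjoint_left]
          intro p hp hpB
          exact (Finset.mem_filter.1 hp).2 (Finset.mem_filter.1 hpB).2.1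
        -- A larger gain stands earlier in the list, and its path would then already meet `X`.
        have hle : ∀ p ∈ B, gain w M p ≤ γ := by
          intro p hp
          obtain ⟨hpA, hpX, -⟩ := Finset.mem_filter.1 hp
          obtain ⟨i, hi⟩ := hgains ⟨M, p, hM, hA p hpA, rfl⟩
          rw [← hi, hγ]
          refine hg.antitone ?_
          rw [Fin.le_def]
          by_contra hlt
          exact hdone p hpA i (not_le.1 hlt) hi.symm hpX
        have hcard : B.card ≤ Y.card := by
          have : ∀ p ∈ B, ∃ v, v ∈ verts p ∧ v ∈ Y := fun p hp =>
            Finset.not_disjoint_iff.1 (Finset.mem_filter.1 hp).2.2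
          choose f hf using this
          refine Finset.card_le_card_of_injective (f := fun p : B => ⟨f p.1 p.2, (hf p.1 p.2).2⟩) ?_
          rintro ⟨p, hp⟩ ⟨q, hq⟩ hpq
          have hpq' : f p hp = f q hq := congrArg Subtype.val hpq
          by_contra hne
          exact Finset.disjoint_left.1 (hdisj p (Finset.mem_filter.1 hp).1 q
            (Finset.mem_filter.1 hq).1 fun h => hne (Subtype.ext h)) (hf p hp).1
              (hpq' ▸ (hf q hq).1)
        have hsum : (∑ p ∈ B, gain w M p) ≤ s * γ * (2 * k + 2) := by
          have h1 : (∑ p ∈ B, gain w M p) ≤ B.card * γ := by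
            simpa using Finset.sum_le_card_nsmul B _ γ hle
          -- The list may contain nonpositive numbers; `γ` is known to be positive only if something
          -- was augmented.
          rcases Nat.eq_zero_or_pos s with rfl | hs
          · have : B.card = 0 := by omega
            simpa [this] using h1
          · have h2 : (B.card : ℝ) ≤ s * (2 * k + 2) := by
              exact_mod_cast hcard.trans hYs
            calc _ ≤ _ := h1
              _ ≤ s * (2 * k + 2) * γ := mul_le_mul_of_nonneg_right h2 (hsγ hs).le
              _ = _ := by ring
        rw [hsplit, Finset.sum_union hdis, hws, add_div]
        have : (∑ p ∈ B, gain w M p) / (2 * k + 2) ≤ s * γ :=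
          (div_le_iff₀ (by positivity)).2 hsum
        linarith
      · intro p hp i hi hgi
        rw [Finset.disjoint_union_right, not_and_or]
        by_cases hpX : Disjoint (verts p) X
        · right
          have hij : (i : ℕ) = j := by
            by_contra hne
            exact hdone p hp i (by omega) hgi hpX
          -- An untouched path is still augmenting with the same gain, so the maximal independent
          -- set must meet it.
          have hcongr := (hA p hp).congr hNj fun v hv e hve =>
            hX e v hve (Finset.disjoint_left.1 hpX hv)
          refine hmeet p ⟨hcongr.1, ?_⟩
          rw [hcongr.2, hgi]
          congr 1
          exact Fin.ext hij
        · exact Or.inl hpX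
  obtain ⟨hN, X, -, hwt, hall⟩ := key T le_rfl
  refine ⟨hN, ?_⟩
  rwa [Finset.filter_true_of_mem] at hwt
  intro p hp
  obtain ⟨i, hi⟩ := hgains ⟨M, p, hM, hA p hp, rfl⟩
  exact hall p hp i i.2 hi.symm

end Step

end WeightedMatching

/-! ### Components of the symmetric difference of two matchings -/

namespace WeightedMatching

universe u

variable {V : Type u} [Fintype V] [DecidableEq V] {G : SimpleGraph V} {M N : Finset (Sym2 V)}

section Components

/-- The edges of `M ∆ N` in the connected component of the vertex `x`. -/
noncomputable def component (M N : Finset (Sym2 V)) (x : V) : Finset (Sym2 V) :=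
  open Classical in (M ∆ N).filter fun e =>
    ∃ v ∈ e, (SimpleGraph.fromEdgeSet (↑(M ∆ N) : Set (Sym2 V))).Reachable x v

lemma mem_component {x : V} {e : Sym2 V} : e ∈ component M N x ↔ e ∈ M ∆ N ∧
    ∃ v ∈ e, (SimpleGraph.fromEdgeSet (↑(M ∆ N) : Set (Sym2 V))).Reachable x v := by
  simp [component]

lemma symmDiff_subset_edgeSet (hM : IsMatching G M) (hN : IsMatching G N) {e : Sym2 V}
    (he : e ∈ M ∆ N) : e ∈ G.edgeSet := by
  rw [Finset.mem_symmDiff] at he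
  exact he.elim (fun h => hM.1 e h.1) fun h => hN.1 e h.1

lemma fromEdgeSet_symmDiff_adj (hM : IsMatching G M) (hN : IsMatching G N) {a b : V} :
    (SimpleGraph.fromEdgeSet (↑(M ∆ N) : Set (Sym2 V))).Adj a b ↔ s(a, b) ∈ M ∆ N := by
  rw [SimpleGraph.fromEdgeSet_adj, Finset.mem_coe]
  refine ⟨fun h => h.1, fun h => ⟨h, ?_⟩⟩
  have : G.Adj a b := symmDiff_subset_edgeSet hM hN h
  exact this.ne

lemma fromEdgeSet_symmDiff_edgeSet (hM : IsMatching G M) (hN : IsMatching G N) :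
    (SimpleGraph.fromEdgeSet (↑(M ∆ N) : Set (Sym2 V))).edgeSet = ↑(M ∆ N) := by
  ext e
  induction e with
  | h a b => rw [SimpleGraph.mem_edgeSet, fromEdgeSet_symmDiff_adj hM hN, Finset.mem_coe]

lemma fromEdgeSet_symmDiff_degree (hM : IsMatching G M) (hN : IsMatching G N) (v a b c : V)
    (ha : (SimpleGraph.fromEdgeSet (↑(M ∆ N) : Set (Sym2 V))).Adj v a)
    (hb : (SimpleGraph.fromEdgeSet (↑(M ∆ N) : Set (Sym2 V))).Adj v b)
    (hc : (SimpleGraph.fromEdgeSet (↑(M ∆ N) : Set (Sym2 V))).Adj v c) :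
    a = b ∨ b = c ∨ a = c := by
  rw [fromEdgeSet_symmDiff_adj hM hN, Finset.mem_symmDiff] at ha hb hc
  have two : ∀ {x y : V} {X : Finset (Sym2 V)}, IsMatching G X → s(v, x) ∈ X → s(v, y) ∈ X →
      x = y := fun hX hx hy => Sym2.congr_right.1
        (hX.eq_of_mem hx hy (Sym2.mem_mk_left _ _) (Sym2.mem_mk_left _ _))
  rcases ha with ha | ha <;> rcases hb with hb | hb <;> rcases hc with hc | hc
  · exact Or.inl (two hM ha.1 hb.1)
  · exact Or.inl (two hM ha.1 hb.1)
  · exact Or.inr (Or.inr (two hM ha.1 hc.1))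
  · exact Or.inr (Or.inl (two hN hb.1 hc.1))
  · exact Or.inr (Or.inl (two hM hb.1 hc.1))
  · exact Or.inr (Or.inr (two hN ha.1 hc.1))
  · exact Or.inl (two hN ha.1 hb.1)
  · exact Or.inl (two hN ha.1 hb.1)

lemma reachable_of_mem_edge (hM : IsMatching G M) (hN : IsMatching G N) {e : Sym2 V}
    (he : e ∈ M ∆ N) {a b : V} (ha : a ∈ e) (hb : b ∈ e) :
    (SimpleGraph.fromEdgeSet (↑(M ∆ N) : Set (Sym2 V))).Reachable a b := by
  by_cases h : a = b
  · rw [h]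
  · have : e = s(a, b) := (Sym2.mem_and_mem_iff h).1 ⟨ha, hb⟩
    rw [this] at he
    exact ((fromEdgeSet_symmDiff_adj hM hN).2 he).reachable

lemma reachable_of_mem_verts_component (hM : IsMatching G M) (hN : IsMatching G N) {x v : V}
    (hv : v ∈ verts (component M N x)) :
    (SimpleGraph.fromEdgeSet (↑(M ∆ N) : Set (Sym2 V))).Reachable x v := by
  obtain ⟨e, he, hve⟩ := mem_verts.1 hv
  obtain ⟨heS, u, hu, hxu⟩ := mem_component.1 he
  exact hxu.trans (reachable_of_mem_edge hM hN heS hu hve)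

lemma component_eq_of_reachable {x y : V}
    (h : (SimpleGraph.fromEdgeSet (↑(M ∆ N) : Set (Sym2 V))).Reachable x y) :
    component M N x = component M N y := by
  ext e
  rw [mem_component, mem_component]
  exact and_congr_right fun _ => exists_congr fun v => and_congr_right fun _ =>
    ⟨h.symm.trans, h.trans⟩

lemma disjoint_verts_component (hM : IsMatching G M) (hN : IsMatching G N) {x y : V}
    (h : component M N x ≠ component M N y) :
    Disjoint (verts (component M N x)) (verts (component M N y)) := by
  refine Finset.disjoint_left.2 fun v hx hy => h ?_
  exact component_eq_of_reachable ((reachable_of_mem_verts_component hM hN hx).trans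
    (reachable_of_mem_verts_component hM hN hy).symm)

lemma isSimplePathOrCycle_component (hM : IsMatching G M) (hN : IsMatching G N) (x : V) :
    IsSimplePathOrCycle G (component M N x) := by
  have hle : SimpleGraph.fromEdgeSet (↑(M ∆ N) : Set (Sym2 V)) ≤ G := by
    intro a b hab
    exact symmDiff_subset_edgeSet hM hN ((fromEdgeSet_symmDiff_adj hM hN).1 hab)
  rcases SimpleGraph.exists_path_or_cycle_of_component _ (fromEdgeSet_symmDiff_degree hM hN) x with
    ⟨u, v, q, hq, h⟩ | ⟨u, q, hq, h⟩
  · refine Or.inl ⟨u, v, q.mapLe hle, hq.mapLe hle, ?_⟩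
    ext e
    rw [List.mem_toFinset, SimpleGraph.Walk.edges_mapLe_eq_edges, h, mem_component,
      fromEdgeSet_symmDiff_edgeSet hM hN, Finset.mem_coe]
  · refine Or.inr ⟨u, q.mapLe hle, hq.mapLe hle, ?_⟩
    ext e
    rw [List.mem_toFinset, SimpleGraph.Walk.edges_mapLe_eq_edges, h, mem_component,
      fromEdgeSet_symmDiff_edgeSet hM hN, Finset.mem_coe]

lemma isAlternating_component (hM : IsMatching G M) (hN : IsMatching G N) (x : V) :
    IsAlternating M (component M N x) := by
  rintro e he f hf hne ⟨v, hve, hvf⟩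
  have he' := Finset.mem_symmDiff.1 (mem_component.1 he).1
  have hf' := Finset.mem_symmDiff.1 (mem_component.1 hf).1
  constructor
  · exact fun h1 h2 => hne (hM.eq_of_mem h1 h2 hve hvf)
  · intro h2
    by_contra h1
    exact hne (hN.eq_of_mem (he'.resolve_left fun h => h1 h.1).1
      (hf'.resolve_left fun h => h2 h.1).1 hve hvf)

/-- Around the vertices of the component the result agrees with `N`, elsewhere with `M`. -/
lemma isMatching_symmDiff_component (hM : IsMatching G M) (hN : IsMatching G N) (x : V) :
    IsMatching G (M ∆ component M N x) := by
  refine isMatching_of_local fun v => ?_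
  by_cases hv : (SimpleGraph.fromEdgeSet (↑(M ∆ N) : Set (Sym2 V))).Reachable x v
  · refine ⟨N, hN, fun e he hve => ?_⟩
    rw [Finset.mem_symmDiff, mem_component] at he
    have : (∃ v ∈ e, (SimpleGraph.fromEdgeSet (↑(M ∆ N) : Set (Sym2 V))).Reachable x v) :=
      ⟨v, hve, hv⟩
    simp only [this, and_true, Finset.mem_symmDiff] at he
    tauto
  · refine ⟨M, hM, fun e he hve => ?_⟩
    rw [Finset.mem_symmDiff] at he
    refine he.elim (fun h => h.1) fun h => absurd ?_ hv
    exact reachable_of_mem_verts_component hM hN (mem_verts.2 ⟨e, h.1, hve⟩)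

lemma biUnion_component (M N : Finset (Sym2 V)) :
    (Finset.univ.image (component M N)).biUnion id = M ∆ N := by
  ext e
  rw [Finset.mem_biUnion]
  constructor
  · rintro ⟨p, hp, he⟩
    obtain ⟨x, -, rfl⟩ := Finset.mem_image.1 hp
    exact (mem_component.1 he).1
  · intro he
    induction e with
    | h a b =>
      exact ⟨_, Finset.mem_image_of_mem _ (Finset.mem_univ a),
        mem_component.2 ⟨he, a, Sym2.mem_mk_left _ _, .refl a⟩⟩

/-- If the components of `M ∆ N` have at most `k` edges of `N`, then the profitable ones form a
vertex-disjoint family of augmentations that gains at least `w(N) - w(M)`. -/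
lemma exists_augmentations (w : Sym2 V → ℝ) (k : ℕ) (hM : IsMatching G M) (hN : IsMatching G N)
    (hk : ∀ x, (component M N x \ M).card ≤ k) :
    ∃ A : Finset (Finset (Sym2 V)), (∀ p ∈ A, IsBoundedAugmenting G w k M p) ∧
      (∀ p ∈ A, ∀ q ∈ A, p ≠ q → Disjoint (verts p) (verts q)) ∧
      weight w N - weight w M ≤ ∑ p ∈ A, gain w M p := by
  classical
  have hdisj : ∀ p ∈ Finset.univ.image (component M N), ∀ q ∈ Finset.univ.image (component M N),
      p ≠ q → Disjoint (verts p) (verts q) := by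
    intro p hp q hq hpq
    obtain ⟨x, -, rfl⟩ := Finset.mem_image.1 hp
    obtain ⟨y, -, rfl⟩ := Finset.mem_image.1 hq
    exact disjoint_verts_component hM hN hpq
  refine ⟨(Finset.univ.image (component M N)).filter fun p => 0 < gain w M p, ?_, ?_, ?_⟩
  · intro p hp
    obtain ⟨hp, hpos⟩ := Finset.mem_filter.1 hp
    obtain ⟨x, -, rfl⟩ := Finset.mem_image.1 hp
    exact ⟨⟨isSimplePathOrCycle_component hM hN x, isAlternating_component hM hN x,
      isMatching_symmDiff_component hM hN x, hpos⟩, hk x⟩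
  · exact fun p hp q hq => hdisj p (Finset.mem_filter.1 hp).1 q (Finset.mem_filter.1 hq).1
  · have h1 : weight w N = weight w M + gain w M (M ∆ N) := by
      rw [← weight_symmDiff, symmDiff_symmDiff_cancel_left]
    have h2 := gain_biUnion w M (Finset.univ.image (component M N)) id
      fun p hp q hq hpq => disjoint_of_disjoint_verts (hdisj p hp q hq hpq)
    rw [biUnion_component] at h2
    have h3 := Finset.sum_filter_add_sum_filter_not (Finset.univ.image (component M N))
      (fun p => 0 < gain w M p) (gain w M)
    have h4 : ∑ p ∈ Finset.univ.image (component M N) with ¬ 0 < gain w M p, gain w M p ≤ 0 :=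
      Finset.sum_nonpos fun p hp => not_lt.1 (Finset.mem_filter.1 hp).2
    simp only [id] at h2
    linarith

end Components

/-! ### Cutting the competitor into short pieces -/

section Trim

/-- Edges of `N` are adjacent if they are joined by an edge of `M`. -/
def linkGraph (M N : Finset (Sym2 V)) : SimpleGraph (Sym2 V) where
  Adj e f := e ≠ f ∧ e ∈ N ∧ f ∈ N ∧ ∃ u ∈ e, ∃ v ∈ f, s(u, v) ∈ M
  symm := ⟨fun _ _ ⟨h, he, hf, u, hu, v, hv, huv⟩ =>
    ⟨h.symm, hf, he, v, hv, u, hu, Sym2.eq_swap ▸ huv⟩⟩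
  loopless := ⟨fun _ h => h.1 rfl⟩

/-- Of three links at `e`, two leave from the same endpoint. That endpoint has one edge of `M`,
whose other end lies on at most one edge of `N`. -/
lemma linkGraph_degree (hM : IsMatching G M) (hN : IsMatching G N) (e a b c : Sym2 V)
    (ha : (linkGraph M N).Adj e a) (hb : (linkGraph M N).Adj e b)
    (hc : (linkGraph M N).Adj e c) : a = b ∨ b = c ∨ a = c := by
  obtain ⟨-, he, haN, u₁, hu₁, v₁, hv₁, h₁⟩ := ha
  obtain ⟨-, -, hbN, u₂, hu₂, v₂, hv₂, h₂⟩ := hb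
  obtain ⟨-, -, hcN, u₃, hu₃, v₃, hv₃, h₃⟩ := hc
  have two : ∀ {x y : Sym2 V} {u v v' : V}, x ∈ N → y ∈ N → v ∈ x → v' ∈ y → s(u, v) ∈ M →
      s(u, v') ∈ M → x = y := by
    intro x y u v v' hx hy hv hv' h h'
    have : v = v' := Sym2.congr_right.1
      (hM.eq_of_mem h h' (Sym2.mem_mk_left _ _) (Sym2.mem_mk_left _ _))
    subst this
    exact hN.eq_of_mem hx hy hv hv'
  have hu : u₁ = u₂ ∨ u₂ = u₃ ∨ u₁ = u₃ := by
    induction e with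
    | h p q =>
      rw [Sym2.mem_iff] at hu₁ hu₂ hu₃
      rcases hu₁ with rfl | rfl <;> rcases hu₂ with rfl | rfl <;> rcases hu₃ with rfl | rfl <;>
        simp
  rcases hu with rfl | rfl | rfl
  · exact Or.inl (two haN hbN hv₁ hv₂ h₁ h₂)
  · exact Or.inr (Or.inl (two hbN hcN hv₂ hv₃ h₂ h₃))
  · exact Or.inr (Or.inr (two haN hcN hv₁ hv₃ h₁ h₃))

/-- A labelling of `N` that is constant across edges of `M` is constant on components. -/
lemma label_eq_of_mem_component {ι : Type*} (hM : IsMatching G M) (hN : IsMatching G N)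
    (φ : Sym2 V → ι) (hφ : ∀ e ∈ N, ∀ f ∈ N, ∀ u ∈ e, ∀ v ∈ f, s(u, v) ∈ M → φ e = φ f)
    {e f : Sym2 V} (he : e ∈ N) (hf : f ∈ N) {a b : V} (ha : a ∈ e) (hb : b ∈ f)
    (hab : (SimpleGraph.fromEdgeSet (↑(M ∆ N) : Set (Sym2 V))).Reachable a b) : φ f = φ e := by
  -- The second conjunct strengthens the induction: it carries the label across the edge of `M` at
  -- `a`, which `a` may have without lying on any edge of `N`.
  have main : ∀ (a b : V)
      (_ : (SimpleGraph.fromEdgeSet (↑(M ∆ N) : Set (Sym2 V))).Walk a b) (e : Sym2 V),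
      e ∈ N → b ∈ e → (∀ f ∈ N, a ∈ f → φ f = φ e) ∧
        ∀ a', s(a, a') ∈ M → ∀ f ∈ N, a' ∈ f → φ f = φ e := by
    intro a b r e he hbe
    induction r with
    | nil =>
      refine ⟨fun f hf haf => by rw [hN.eq_of_mem hf he haf hbe], fun a' ha' f hf haf => ?_⟩
      exact (hφ e he f hf _ hbe a' haf ha').symm
    | @cons x y _ hxy r ih =>
      obtain ⟨ih1, ih2⟩ := ih hbe
      rw [fromEdgeSet_symmDiff_adj hM hN, Finset.mem_symmDiff] at hxy
      rcases hxy with hxy | hxy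
      · refine ⟨ih2 x (Sym2.eq_swap ▸ hxy.1), fun a' ha' f hf haf => ?_⟩
        have : a' = y := Sym2.congr_right.1
          (hM.eq_of_mem ha' hxy.1 (Sym2.mem_mk_left _ _) (Sym2.mem_mk_left _ _))
        exact ih1 f hf (this ▸ haf)
      · have h := ih1 _ hxy.1 (Sym2.mem_mk_right x y)
        refine ⟨fun f hf hxf => ?_, fun a' ha' f hf haf => ?_⟩
        · rw [hN.eq_of_mem hf hxy.1 hxf (Sym2.mem_mk_left x y), h]
        · rw [← h]
          exact (hφ _ hxy.1 f hf x (Sym2.mem_mk_left x y) a' haf ha').symm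
  obtain ⟨r⟩ := hab.symm
  exact (main _ _ r e he ha).1 f hf hb

/-- Every matching `M` admits a vertex-disjoint family of short augmentations that gains almost
`w(M') - w(M)`, where `M'` is any other matching. -/
theorem exists_augmentations_of_isMatching {w : Sym2 V → ℝ} (hw : ∀ e ∈ G.edgeSet, 0 ≤ w e)
    (k : ℕ) {M' : Finset (Sym2 V)} (hM : IsMatching G M) (hM' : IsMatching G M') :
    ∃ A : Finset (Finset (Sym2 V)), (∀ p ∈ A, IsBoundedAugmenting G w k M p) ∧
      (∀ p ∈ A, ∀ q ∈ A, p ≠ q → Disjoint (verts p) (verts q)) ∧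
      (1 - 2 / (k + 1)) * weight w M' - weight w M ≤ ∑ p ∈ A, gain w M p := by
  obtain ⟨N, hNM', hwN, φ, hφ, hcard⟩ := (linkGraph M M').exists_light_deletion
    (linkGraph_degree hM hM') M' w (fun e he => hw e (hM'.1 e he)) k
  have hN : IsMatching G N := hM'.mono hNM'
  have hφ' : ∀ e ∈ N, ∀ f ∈ N, ∀ u ∈ e, ∀ v ∈ f, s(u, v) ∈ M → φ e = φ f := by
    intro e he f hf u hu v hv huv
    by_cases hne : e = f
    · rw [hne]
    · exact hφ e he f hf ⟨hne, hNM' he, hNM' hf, u, hu, v, hv, huv⟩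
  have hsub : ∀ x, component M N x \ M ⊆ N := by
    intro x e he
    obtain ⟨he, heM⟩ := Finset.mem_sdiff.1 he
    exact ((Finset.mem_symmDiff.1 (mem_component.1 he).1).resolve_left fun h => heM h.1).1
  have hk : ∀ x, (component M N x \ M).card ≤ k := by
    intro x
    rcases (component M N x \ M).eq_empty_or_nonempty with h | ⟨e, he⟩
    · simp [h]
    · refine hcard (φ e) _ (hsub x) fun f hf => ?_
      obtain ⟨-, a, ha, hxa⟩ := mem_component.1 (Finset.mem_sdiff.1 he).1
      obtain ⟨-, b, hb, hxb⟩ := mem_component.1 (Finset.mem_sdiff.1 hf).1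
      exact label_eq_of_mem_component hM hN φ hφ' (hsub x he) (hsub x hf) ha hb
        (hxa.symm.trans hxb)
  obtain ⟨A, hA, hdisj, hsum⟩ := exists_augmentations w k hM hN hk
  exact ⟨A, hA, hdisj, (sub_le_sub_right hwN _).trans hsum⟩

end Trim

/-! ### Geometric decay of the deficit -/

/-- The weight after `L` phases, compared with any matching `M'`. -/
theorem IsOutput.weight_ge {w : Sym2 V → ℝ} (hw : ∀ e ∈ G.edgeSet, 0 ≤ w e) {k L T : ℕ}
    {g : Fin T → ℝ} (hg : StrictAnti g) (hgains : possibleGains G w k ⊆ Set.range g)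
    (h : IsOutput G w k L g M) : IsMatching G M ∧ ∀ M', IsMatching G M' →
      (1 - 2 / ((k : ℝ) + 1)) * (1 - (1 - 1 / (2 * (k : ℝ) + 2)) ^ L) * weight w M' ≤
        weight w M := by
  obtain ⟨N, h0, hstep, rfl⟩ := h
  have hmatch : ∀ i ≤ L, IsMatching G (N i) := by
    intro i
    induction i with
    | zero => exact fun _ => h0 ▸ isMatching_empty G
    | succ i ih =>
      intro hi
      exact ((hstep i hi).weight_ge hg hgains (ih (by omega)) ∅ (by simp) (by simp)).1
  refine ⟨hmatch L le_rfl, fun M' hM' => ?_⟩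
  set O := (1 - 2 / ((k : ℝ) + 1)) * weight w M' with hO
  have hδ : 0 ≤ 1 - 1 / (2 * (k : ℝ) + 2) := by
    rw [sub_nonneg, div_le_one (by positivity)]
    linarith [(Nat.cast_nonneg k : (0 : ℝ) ≤ k)]
  -- The family available in phase `i` has total gain at least the deficit `O - weight w (N i)`, and
  -- the phase earns 1/(2k+2) of it. A negative deficit does no harm.
  have key : ∀ i ≤ L, O - weight w (N i) ≤ (1 - 1 / (2 * (k : ℝ) + 2)) ^ i * O := by
    intro i
    induction i with
    | zero =>
      intro _
      rw [h0]
      simp [weight]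
    | succ i ih =>
      intro hi
      obtain ⟨A, hA, hdisj, hsum⟩ :=
        exists_augmentations_of_isMatching hw k (hmatch i (by omega)) hM'
      have h1 := ((hstep i hi).weight_ge hg hgains (hmatch i (by omega)) A hA hdisj).2
      have h2 : (O - weight w (N i)) / (2 * k + 2) ≤
          (∑ p ∈ A, gain w (N i) p) / (2 * k + 2) := by gcongr
      calc O - weight w (N (i + 1))
          ≤ O - (weight w (N i) + (O - weight w (N i)) / (2 * k + 2)) := by linarith
        _ = (1 - 1 / (2 * (k : ℝ) + 2)) * (O - weight w (N i)) := by ring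
        _ ≤ (1 - 1 / (2 * (k : ℝ) + 2)) * ((1 - 1 / (2 * (k : ℝ) + 2)) ^ i * O) :=
          mul_le_mul_of_nonneg_left (ih (by omega)) hδ
        _ = _ := by ring
  have := key L le_rfl
  calc _ = O - (1 - 1 / (2 * (k : ℝ) + 2)) ^ L * O := by rw [hO]; ring
    _ ≤ _ := by linarith

end WeightedMatching

/-! ### Counting gains and phases -/

namespace WeightedMatching

universe u

variable {V : Type u} [Fintype V] [DecidableEq V] {G : SimpleGraph V}

lemma IsAugmenting.subset_edgeSet {w : Sym2 V → ℝ} {M p : Finset (Sym2 V)}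
    (h : IsAugmenting G w M p) (hM : IsMatching G M) {e : Sym2 V} (he : e ∈ p) :
    e ∈ G.edgeSet := by
  by_cases heM : e ∈ M
  · exact hM.1 e heM
  · exact h.2.2.1.1 e (Finset.mem_symmDiff.2 (Or.inr ⟨he, heM⟩))

/-- Padding with zeros gives every sum the same number of terms, so that sums can be counted by
functions on `Fin n`; this is why 0 is put into `S`. -/
lemma exists_weight_eq_sum (w : Sym2 V → ℝ) (S : Finset ℝ) (h0 : 0 ∈ S) (n : ℕ) :
    ∀ A : Finset (Sym2 V), (∀ e ∈ A, w e ∈ S) → A.card ≤ n →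
      ∃ f : Fin n → ℝ, (∀ i, f i ∈ S) ∧ weight w A = ∑ i, f i := by
  induction n with
  | zero =>
    intro A _ hA
    have : A = ∅ := Finset.card_eq_zero.1 (by omega)
    exact ⟨Fin.elim0, fun i => i.elim0, by simp [this, weight]⟩
  | succ n ih =>
    intro A hAS hA
    rcases A.eq_empty_or_nonempty with rfl | ⟨a, ha⟩
    · exact ⟨fun _ => 0, fun _ => h0, by simp [weight]⟩
    · obtain ⟨f, hf, hsum⟩ := ih (A.erase a) (fun e he => hAS e (Finset.mem_of_mem_erase he))
        (by rw [Finset.card_erase_of_mem ha]; omega)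
      refine ⟨Fin.cons (w a) f, fun i => ?_, ?_⟩
      · refine Fin.cases ?_ (fun i => ?_) i
        · exact hAS a ha
        · exact hf i
      · rw [Fin.sum_univ_succ]
        simp only [Fin.cons_zero, Fin.cons_succ]
        rw [← hsum, weight, weight, Finset.add_sum_erase _ _ ha]

/-- If the weights take few values, then there are few gains. -/
lemma ncard_possibleGains_le (w : Sym2 V → ℝ) (k : ℕ) (S : Finset ℝ) (h0 : 0 ∈ S)
    (hS : ∀ e ∈ G.edgeSet, w e ∈ S) :
    (possibleGains G w k).ncard ≤ S.card ^ (2 * k + 1) := by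
  classical
  let F : Finset ℝ := ((Fintype.piFinset fun _ : Fin k => S) ×ˢ
    (Fintype.piFinset fun _ : Fin (k + 1) => S)).image fun f => ∑ i, f.1 i - ∑ i, f.2 i
  have hsub : possibleGains G w k ⊆ F := by
    rintro γ ⟨M, p, hM, hp, rfl⟩
    obtain ⟨f, hf, hf'⟩ := exists_weight_eq_sum w S h0 k (p \ M)
      (fun e he => hS e (hp.1.subset_edgeSet hM (Finset.mem_sdiff.1 he).1)) hp.2
    obtain ⟨f', hf2, hf2'⟩ := exists_weight_eq_sum w S h0 (k + 1) (p ∩ M)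
      (fun e he => hS e (hp.1.subset_edgeSet hM (Finset.mem_inter.1 he).1))
      ((hp.1.card_inter_le hM).trans (Nat.succ_le_succ hp.2))
    rw [Finset.mem_coe, Finset.mem_image]
    refine ⟨(f, f'), ?_, ?_⟩
    · rw [Finset.mem_product, Fintype.mem_piFinset, Fintype.mem_piFinset]
      exact ⟨hf, hf2⟩
    · rw [gain, hf', hf2']
  calc (possibleGains G w k).ncard ≤ (F : Set ℝ).ncard :=
        Set.ncard_le_ncard hsub F.finite_toSet
    _ = F.card := Set.ncard_coe_finset F
    _ ≤ _ := Finset.card_image_le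
    _ = S.card ^ (2 * k + 1) := by
      rw [Finset.card_product, Fintype.card_piFinset_const, Fintype.card_piFinset_const]
      ring

/-- As log(1 - ε/3) ≤ -ε/3, all exponents lie between 0 and B = (3/ε) log(1/w_min). With the padding
value 0 this makes at most ⌊B⌋ + 2 ≤ 3B values; the last inequality needs B ≥ 1, which holds because
some weight is below 1. -/
theorem ncard_possibleGains_le_of_pow {w : Sym2 V → ℝ} {ε : ℝ} (hε : 0 < ε) (hε1 : ε < 1)
    (hw : ∀ e ∈ G.edgeSet, 0 < w e ∧ w e ≤ 1 ∧ ∃ a : ℤ, w e = (1 - ε / 3) ^ a)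
    (hn : ∀ e ∈ G.edgeSet, ε / Fintype.card V ≤ w e) (hlt : wmin G w ε < 1) (k : ℕ) :
    ((possibleGains G w k).ncard : ℝ) ≤
      (9 * (1 / ε * Real.log (1 / wmin G w ε))) ^ (2 * k + 1) := by
  have hnonneg : 0 ≤ wmin G w ε := le_max_of_le_left (by positivity)
  have hlog : 0 ≤ Real.log (1 / wmin G w ε) := by
    rw [one_div, Real.log_inv]
    linarith [Real.log_nonpos hnonneg hlt.le]
  rcases (w '' G.edgeSet).eq_empty_or_nonempty with hE | hE
  · have : possibleGains G w k = ∅ := by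
      rw [Set.eq_empty_iff_forall_notMem]
      rintro γ ⟨M, p, hM, hp, -⟩
      obtain ⟨e, he⟩ := hp.1.nonempty
      exact Set.notMem_empty _ (hE ▸ Set.mem_image_of_mem w (hp.1.subset_edgeSet hM he))
    rw [this]
    simp only [Set.ncard_empty, Nat.cast_zero]
    positivity
  have hfin : (w '' G.edgeSet).Finite := Set.toFinite _
  obtain ⟨e₀, he₀, hmin⟩ := hE.csInf_mem hfin
  have hpos : 0 < wmin G w ε := lt_max_of_lt_right (hmin ▸ (hw e₀ he₀).1)
  have hle : ∀ e ∈ G.edgeSet, wmin G w ε ≤ w e := fun e he =>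
    max_le (hn e he) (csInf_le hfin.bddBelow (Set.mem_image_of_mem w he))
  set B := 3 / ε * Real.log (1 / wmin G w ε) with hB
  have hbase : 0 < 1 - ε / 3 := by linarith
  have hexp : ∀ e ∈ G.edgeSet, ∃ a : ℕ, w e = (1 - ε / 3) ^ a ∧ (a : ℝ) ≤ B := by
    intro e he
    obtain ⟨h1, h2, a, ha⟩ := hw e he
    have ha0 : 0 ≤ a := by
      by_contra hneg
      have := one_lt_zpow_of_neg₀ hbase (by linarith) (not_le.1 hneg)
      linarith
    obtain ⟨n, rfl⟩ := Int.eq_ofNat_of_zero_le ha0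
    rw [zpow_natCast] at ha
    refine ⟨n, ha, ?_⟩
    have h3 := Real.log_le_log hpos (hle e he)
    rw [ha, Real.log_pow] at h3
    have h4 : Real.log (1 - ε / 3) ≤ -(ε / 3) := by
      linarith [Real.log_le_sub_one_of_pos hbase]
    have h5 : (n : ℝ) * Real.log (1 - ε / 3) ≤ n * -(ε / 3) :=
      mul_le_mul_of_nonneg_left h4 (Nat.cast_nonneg n)
    have h6 : (n : ℝ) * (ε / 3) ≤ Real.log (1 / wmin G w ε) := by
      rw [one_div, Real.log_inv]
      linarith
    calc (n : ℝ) = 3 / ε * (n * (ε / 3)) := by field_simp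
      _ ≤ B := mul_le_mul_of_nonneg_left h6 (by positivity)
  have hB1 : 1 ≤ B := by
    obtain ⟨a, ha, haB⟩ := hexp e₀ he₀
    have hw1 : w e₀ < 1 := by
      rw [hmin]
      exact (le_max_right _ _).trans_lt hlt
    have : 1 ≤ a := by
      by_contra h
      have : a = 0 := by omega
      rw [ha, this, pow_zero] at hw1
      exact lt_irrefl _ hw1
    exact le_trans (by exact_mod_cast this) haB
  have hcard := ncard_possibleGains_le (G := G) w k
    (insert 0 ((Finset.range (⌊B⌋₊ + 1)).image fun i => (1 - ε / 3) ^ i))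
    (Finset.mem_insert_self _ _) (by
      intro e he
      obtain ⟨a, ha, haB⟩ := hexp e he
      refine Finset.mem_insert_of_mem (Finset.mem_image.2 ⟨a, ?_, ha.symm⟩)
      exact Finset.mem_range.2 (Nat.lt_succ_of_le (Nat.le_floor haB)))
  have hS : (insert 0 ((Finset.range (⌊B⌋₊ + 1)).image fun i => (1 - ε / 3) ^ i)).card ≤
      ⌊B⌋₊ + 2 := by
    refine (Finset.card_insert_le _ _).trans ?_
    have := Finset.card_image_le (s := Finset.range (⌊B⌋₊ + 1)) (f := fun i => (1 - ε / 3) ^ i)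
    rw [Finset.card_range] at this
    omega
  have hS' : ((⌊B⌋₊ + 2 : ℕ) : ℝ) ≤ 9 * (1 / ε * Real.log (1 / wmin G w ε)) := by
    have h1 := Nat.floor_le (by linarith : 0 ≤ B)
    have h2 : 9 * (1 / ε * Real.log (1 / wmin G w ε)) = 3 * B := by rw [hB]; ring
    push_cast
    linarith
  calc ((possibleGains G w k).ncard : ℝ) ≤ ((⌊B⌋₊ + 2 : ℕ) : ℝ) ^ (2 * k + 1) := by
        exact_mod_cast hcard.trans (Nat.pow_le_pow_left hS _)
    _ ≤ _ := pow_le_pow_left₀ (Nat.cast_nonneg _) hS' _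

/-- The number of phases suffices. -/
lemma one_sub_le_of_phases {ε : ℝ} (hε : 0 < ε) (hε1 : ε < 1) {L : ℕ}
    (hL : 410 * (1 / ε * Real.log (1 / ε)) ≤ L) :
    1 - ε ≤ (1 - 2 / ((⌈3 / ε⌉₊ : ℝ) + 1)) * (1 - (1 - 1 / (2 * (⌈3 / ε⌉₊ : ℝ) + 2)) ^ L) := by
  set k : ℝ := (⌈3 / ε⌉₊ : ℝ) with hk
  have hk1 : 3 / ε ≤ k := Nat.le_ceil _
  have hk2 : k < 3 / ε + 1 := Nat.ceil_lt_add_one (by positivity)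
  have hk3 : 0 < 3 / ε := by positivity
  have hlog : 0 < Real.log (1 / ε) := Real.log_pos (by rw [lt_div_iff₀ hε]; linarith)
  have hα : 1 - 2 * ε / 3 ≤ 1 - 2 / (k + 1) := by
    have : 2 / (k + 1) ≤ 2 / (3 / ε) := by gcongr; linarith
    have h2 : 2 / (3 / ε) = 2 * ε / 3 := by field_simp
    linarith
  -- Since k < 3/ε + 1 and ε < 1, 2k + 2 < 6/ε + 4 < 10/ε.
  have hδ : ε / 10 ≤ 1 / (2 * k + 2) := by
    rw [le_div_iff₀ (by linarith)]
    have h1 : ε * (3 / ε) = 3 := by field_simp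
    nlinarith
  have hδ1 : 1 / (2 * k + 2) ≤ 1 := by
    rw [div_le_one (by linarith)]; linarith
  have hpow : (1 - 1 / (2 * k + 2)) ^ L ≤ (1 - ε / 10) ^ L :=
    pow_le_pow_left₀ (by linarith) (by linarith) L
  have hL0 : 1 ≤ L := by
    have : (0 : ℝ) < L := lt_of_lt_of_le (by positivity) hL
    exact_mod_cast this
  have hpow0 : 0 ≤ (1 - ε / 10) ^ L := by
    have : 0 ≤ 1 - ε / 10 := by linarith
    positivity
  suffices h : 1 - ε ≤ (1 - 2 * ε / 3) * (1 - (1 - ε / 10) ^ L) by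
    refine h.trans (mul_le_mul hα (by linarith) ?_ (by linarith))
    rw [sub_nonneg]
    exact pow_le_one₀ (by linarith) (by linarith)
  -- For ε ≤ 30/31 the choice 410 = 10 · 41 gives a remainder of at most ε^41 ≤ ε/3, and (1 -
  -- 2ε/3)(1 - ε/3) ≥ 1 - ε. Near 1 the logarithm degenerates, but a single phase already leaves (1
  -- - 2ε/3) ε/10 ≥ 1 - ε.
  rcases le_total ε (30 / 31) with hs | hs
  · have h1 : (1 - ε / 10) ^ L ≤ ε ^ 41 := by
      calc (1 - ε / 10) ^ L ≤ Real.exp (-(ε / 10)) ^ L :=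
            pow_le_pow_left₀ (by linarith) (by linarith [Real.add_one_le_exp (-(ε / 10))]) L
        _ = Real.exp (-(ε / 10) * L) := by rw [← Real.exp_nat_mul, mul_comm]
        _ ≤ Real.exp (41 * Real.log ε) := by
            refine Real.exp_le_exp.2 ?_
            have h3 : ε / 10 * (410 * (1 / ε * Real.log (1 / ε))) ≤ ε / 10 * L := by gcongr
            have h4 : ε / 10 * (410 * (1 / ε * Real.log (1 / ε))) = -(41 * Real.log ε) := by
              rw [one_div ε, Real.log_inv]
              field_simp
              ring
            linarith
        _ = ε ^ 41 := by
            rw [← Real.exp_log hε, ← Real.exp_nat_mul, Real.exp_log hε]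
            norm_num
    have h2 : ε ^ 41 ≤ ε / 3 := by
      have : ε ^ 40 ≤ (30 / 31) ^ 40 := pow_le_pow_left₀ hε.le hs 40
      have h3 : ((30 : ℝ) / 31) ^ 40 ≤ 1 / 3 := by norm_num
      calc ε ^ 41 = ε * ε ^ 40 := by ring
        _ ≤ ε * (1 / 3) := by gcongr; linarith
        _ = ε / 3 := by ring
    have h3 : (1 - ε / 10) ^ L ≤ ε / 3 := h1.trans h2
    nlinarith
  · have h1 : (1 - ε / 10) ^ L ≤ 1 - ε / 10 :=
      pow_le_of_le_one (by linarith) (by linarith) (by omega)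
    nlinarith

end WeightedMatching
theorem mainTheorem6 :
    ∃ cL : ℝ, 0 < cL ∧ ∃ cT : ℝ, 0 < cT ∧
      ∀ (V : Type*) [Fintype V] [DecidableEq V] (G : SimpleGraph V) (w : Sym2 V → ℝ) (ε : ℝ),
        0 < ε → ε < 1 →
        (∀ e ∈ G.edgeSet, 0 < w e ∧ w e ≤ 1 ∧ ∃ a : ℤ, w e = (1 - ε / 3) ^ a) →
        -- the bound that makes `T_k = Θ(ε⁻¹ log (1 / w_min(ε)))^(2k+1)` gain slots sufficient
        ((∀ e ∈ G.edgeSet, ε / Fintype.card V ≤ w e) → WeightedMatching.wmin G w ε < 1 →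
          ((WeightedMatching.possibleGains G w ⌈3 / ε⌉₊).ncard : ℝ) ≤
            (cT * (1 / ε * Real.log (1 / WeightedMatching.wmin G w ε))) ^ (2 * ⌈3 / ε⌉₊ + 1)) ∧
        -- correctness of the algorithm, for every admissible choice of `L` and of the gain list
        (∀ (L : ℕ), cL * (1 / ε * Real.log (1 / ε)) ≤ (L : ℝ) →
          ∀ (T : ℕ) (g : Fin T → ℝ), StrictAnti g →
            WeightedMatching.possibleGains G w ⌈3 / ε⌉₊ ⊆ Set.range g →
            (∃ M, WeightedMatching.IsOutput G w ⌈3 / ε⌉₊ L g M) ∧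
              ∀ M, WeightedMatching.IsOutput G w ⌈3 / ε⌉₊ L g M →
                WeightedMatching.IsApproxMWM G w (1 - ε) M) := by
  refine ⟨410, by norm_num, 9, by norm_num, ?_⟩
  intro V _ _ G w ε hε hε1 hw
  refine ⟨fun hn hlt =>
    WeightedMatching.ncard_possibleGains_le_of_pow hε hε1 hw hn hlt _, ?_⟩
  intro L hL T g hg hgains
  refine ⟨WeightedMatching.exists_isOutput G w _ L g, fun M hM => ?_⟩
  have hw0 : ∀ e ∈ G.edgeSet, 0 ≤ w e := fun e he => (hw e he).1.le
  obtain ⟨hmatch, hge⟩ := hM.weight_ge hw0 hg hgains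
  refine ⟨hmatch, fun M' hM' => le_trans ?_ (hge M' hM')⟩
  exact mul_le_mul_of_nonneg_right (WeightedMatching.one_sub_le_of_phases hε hε1 hL)
    (Finset.sum_nonneg fun e he => hw0 e (hM'.1 e he))
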